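/- Let \(k\) be a field that is complete with respect to a (possibly trivial) non-Archimedean absolute value and maximally complete, i.e. every extension of valued fields \(K/k\) with the same value group and the same residue field is trivial. Let \(\mathbf{A}^{1,\mathrm{an}}_k\) be the Berkovich affine line: the set of multiplicative seminorms \(P\mapsto |P(x)|\) on \(k[T]\) extending the absolute value of \(k\), with the coarsest topology making all the maps \(x\mapsto|P(x)|\) continuous, and ordered by \(x\le y\) if and only if \(|P(x)|\le|P(y)|\) for all \(P\in k[T]\). For an irreducible polynomial \(P\in k[T]\), let \(\eta_{P,0}\) be the unique point at which \(P\) vanishes and, for \(r>0\), let \(\eta_{P,r}\) be the unique point of the Shilov boundary of \(\{|P|\le r\}\). Put \(D_0=\{\eta_{T,1}\}\) and, for \(d\ge 1\), \(D_d=\{\eta_{P,r} : P\in k[T] \text{ irreducible},\ \deg P\le d,\ r\ge 0\}\). Let \(x\) be a point of \(\mathbf{A}^{1,\mathrm{an}}_k\). For every integer \(d\ge 0\) there is a unique point \(x_d\in D_d\) such that \[|P(x_d)|=|P(x)|\quad\text{for all } P\in k[T] \text{ with } \deg P\le d.\] Moreover, if \(d\ge 1\), or if \(d=0\) and \(|T(x)|\le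 1\), then \(x_d\ge x\) and \[x_d=\inf\{y\in D_d : y\ge x\}.\] -/

import Mathlib

open Polynomial

universe u

/-- `k` is maximally complete: it has no non-trivial immediate extension. An extension of `k`, as a
non-Archimedean valued field, is immediate when it has the same value group and the same residue
field as `k`, i.e. when `k` and `K` have the same nonzero absolute values and every element of the
closed unit ball of `K` is congruent, modulo the open unit ball of `K`, to an element of the closed
unit ball of `k`. (`NormedAlgebra k K` makes `k → K` an isometric embedding of fields.) -/
def MaximallyComplete (k : Type u) [NormedField k] : Prop :=
  ∀ (K : Type u) [NormedField K] [IsUltrametricDist K] [NormedAlgebra k K],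
    (∀ z : K, z ≠ 0 → ∃ a : k, a ≠ 0 ∧ ‖a‖ = ‖z‖) →
    (∀ z : K, ‖z‖ ≤ 1 → ∃ a : k, ‖a‖ ≤ 1 ∧ ‖z - algebraMap k K a‖ < 1) →
    Function.Surjective (algebraMap k K)

/-- The set of points of the Berkovich affine line over `k`: the multiplicative seminorms on `k[T]`
that extend the absolute value of `k`. -/
structure BerkovichLine (k : Type u) [NormedField k] extends MulRingSeminorm k[X] where
  map_C' : ∀ a : k, toFun (C a) = ‖a‖

namespace BerkovichLine

variable {k : Type u} [NormedField k]

theorem toMulRingSeminorm_injective :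
    Function.Injective (toMulRingSeminorm : BerkovichLine k → MulRingSeminorm k[X]) := by
  rintro ⟨p, hp⟩ ⟨q, hq⟩ h
  cases h
  rfl

/-- `x P` is the real number written `|P(x)|`. -/
noncomputable instance instFunLike : FunLike (BerkovichLine k) k[X] ℝ where
  coe x := x.toMulRingSeminorm
  coe_injective _ _ h := toMulRingSeminorm_injective (DFunLike.coe_injective h)

/-- `x ≤ y` when `|P(x)| ≤ |P(y)|` for every polynomial `P`. -/
noncomputable instance instPartialOrder : PartialOrder (BerkovichLine k) where
  le x y := ∀ P : k[X], x P ≤ y P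
  le_refl _ _ := le_rfl
  le_trans _ _ _ h₁ h₂ P := (h₁ P).trans (h₂ P)
  le_antisymm x y h₁ h₂ := DFunLike.ext x y fun P => le_antisymm (h₁ P) (h₂ P)

/-- The topology of the Berkovich line: the coarsest one that makes all the functions
`x ↦ |P(x)|` continuous. -/
noncomputable instance instTopologicalSpace : TopologicalSpace (BerkovichLine k) :=
  TopologicalSpace.induced (fun (x : BerkovichLine k) (P : k[X]) => x P) inferInstance

/-- The (virtual) disc `{|P| ≤ r}`. -/
def disc (P : k[X]) (r : ℝ) : Set (BerkovichLine k) :=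
  {x | x P ≤ r}

/-- `Γ` is a closed boundary of the domain `V`: a closed subset of `V` on which every function has
its maximum over `V`. For `V = {|P| ≤ r}`, the polynomials are dense in the affinoid algebra of `V`,
hence a closed subset is a boundary for the affinoid algebra exactly when it is one for the
polynomials. -/
def IsBoundary (V Γ : Set (BerkovichLine k)) : Prop :=
  Γ ⊆ V ∧ IsClosed Γ ∧ ∀ f : k[X], ∃ z ∈ Γ, ∀ y ∈ V, y f ≤ z f

/-- `Γ` is the Shilov boundary of `V`: the smallest closed boundary. -/
def IsShilovBoundary (V Γ : Set (BerkovichLine k)) : Prop :=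
  IsLeast {Δ | IsBoundary V Δ} Γ

/-- For an irreducible polynomial `P` and `r ≥ 0`, `IsEta P r y` says that `y` is the point
`η_{P,r}`: if `r = 0`, the point where `P` vanishes; if `r > 0`, the unique point of the Shilov
boundary of `{|P| ≤ r}`. -/
def IsEta (P : k[X]) (r : ℝ) (y : BerkovichLine k) : Prop :=
  (r = 0 ∧ y P = 0) ∨ (0 < r ∧ IsShilovBoundary (disc P r) {y})

/-- `D_0 = {η_{T,1}}`, and, for `d ≥ 1`, `D_d` is the set of the points `η_{P,r}` with `P`
irreducible of degree at most `d` and `r ≥ 0`. -/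
def D (k : Type u) [NormedField k] (d : ℕ) : Set (BerkovichLine k) :=
  {y | (d = 0 ∧ IsEta X 1 y) ∨
    (1 ≤ d ∧ ∃ P : k[X], Irreducible P ∧ P.natDegree ≤ d ∧ ∃ r : ℝ, 0 ≤ r ∧ IsEta P r y)}

/-- `y` and `x` give the same absolute value to every polynomial of degree at most `d`. -/
def AgreeUpTo (d : ℕ) (y x : BerkovichLine k) : Prop :=
  ∀ P : k[X], P.natDegree ≤ d → y P = x P

end BerkovichLine

/-! The argument has three ingredients.

Orthogonality. A maximally complete field is spherically complete
(`MaximallyComplete.exists_forall_norm_sub_le`): a nested sequence of discs without common point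
would give, by Kaplansky's construction, a non-trivial immediate extension. By induction on `n`, the
space of polynomials of degree less than `n` is then spherically complete for `x`, so some monic `P`
of degree `n` minimises `x P` (`exists_minimal`). Minimality makes `P` orthogonal to lower degrees:
`x (c P + g)` is the maximum of `‖c‖ * x P` and `x g`.

Geometry. Orthogonality bounds any point vanishing at an irreducible `P` by a multiple of any other
such point, so there is only one such point. Over an algebraically closed extension where `x` is
evaluation at `t`, it follows that `{|P| ≤ |P(x)|}` has a greatest point, induced by a disc having
`t` on its boundary (`exists_isGreatest_comap_gauss`). Two discs containing `t` are nested, so such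
points are comparable. A greatest point is the Shilov boundary, hence is `η_{P,r}`.

Induction on `d`. Let `z` agree with `x` up to degree `d` and let `P` be minimal of degree `d + 1`.
Either `z P ≤ x P` and orthogonality shows that `z` still works, or `P` is irreducible and the
greatest point of `{|P| ≤ |P(x)|}`, squeezed between `x` and `z`, works.

Uniqueness and the infimum are formal: a point of `D k d` is greatest in a disc defined by a
polynomial whose value agreement controls. -/

open scoped NNReal

/-! ### Residue fields of multiplicative seminorms -/

/-- Every multiplicative seminorm on a commutative ring is induced by a ring homomorphism to a
normed field, which can be taken to be generated as a field by the image. -/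
theorem MulRingSeminorm.exists_normedField {R : Type u} [CommRing R] (z : MulRingSeminorm R) :
    ∃ (K : Type u) (_ : NormedField K) (φ : R →+* K), (∀ r, ‖φ r‖ = z r) ∧
      ∀ w, ∃ a b, φ b ≠ 0 ∧ w = φ a / φ b := by
  have z0 : z 0 = 0 := map_zero z
  let I : Ideal R :=
    { carrier := {r | z r = 0}
      zero_mem' := z0
      add_mem' := fun {a b} ha hb => by
        have := map_add_le_add z a b
        simp only [Set.mem_ofPred_eq] at *
        exact le_antisymm (by linarith) (apply_nonneg z _)
      smul_mem' := fun c a ha => by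
        simp only [Set.mem_ofPred_eq, smul_eq_mul, map_mul] at *
        simp [ha] }
  have hI : ∀ r, r ∈ I ↔ z r = 0 := fun r => Iff.rfl
  have : I.IsPrime := by
    refine ⟨fun h => ?_, fun {a b} h => ?_⟩
    · have : (1 : R) ∈ I := h ▸ Submodule.mem_top
      rw [hI, map_one] at this
      exact one_ne_zero this
    · simpa only [hI, map_mul, mul_eq_zero] using h
  let K := FractionRing (R ⧸ I)
  let φ : R →+* K := (algebraMap (R ⧸ I) K).comp (Ideal.Quotient.mk I)
  have hφ : ∀ r, φ r = 0 ↔ z r = 0 := fun r => by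
    simp only [φ, RingHom.comp_apply]
    rw [FaithfulSMul.algebraMap_eq_zero_iff, Ideal.Quotient.eq_zero_iff_mem, hI]
  have hfrac : ∀ w : K, ∃ a b, φ b ≠ 0 ∧ w = φ a / φ b := fun w => by
    obtain ⟨a, b, hb, rfl⟩ := IsFractionRing.div_surjective (A := R ⧸ I) w
    obtain ⟨a, rfl⟩ := Ideal.Quotient.mk_surjective a
    obtain ⟨b, rfl⟩ := Ideal.Quotient.mk_surjective b
    refine ⟨a, b, ?_, rfl⟩
    simpa [φ, Ideal.Quotient.eq_zero_iff_mem] using nonZeroDivisors.ne_zero hb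
  choose num den hden hnd using hfrac
  have hz : ∀ a b c d, φ b ≠ 0 → φ d ≠ 0 → φ a / φ b = φ c / φ d → z a / z b = z c / z d := by
    intro a b c d hb hd h
    rw [div_eq_div_iff hb hd, ← map_mul, ← map_mul, ← sub_eq_zero, ← map_sub, hφ] at h
    have h' : z (a * d) = z (c * b) := by
      have h1 := abs_sub_map_le_sub z (a * d) (c * b)
      rw [h] at h1
      exact sub_eq_zero.mp (abs_nonpos_iff.mp h1)
    rw [Ne, hφ] at hb hd
    rw [div_eq_div_iff hb hd, ← map_mul, ← map_mul, h']
  let N : K → ℝ := fun w => z (num w) / z (den w)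
  have hN : ∀ a b, φ b ≠ 0 → N (φ a / φ b) = z a / z b := fun a b hb =>
    hz _ _ _ _ (hden _) hb (hnd _).symm
  have hpos : ∀ b, φ b ≠ 0 → 0 < z b := fun b hb =>
    lt_of_le_of_ne (apply_nonneg z b) fun h => hb ((hφ b).2 h.symm)
  let v : AbsoluteValue K ℝ :=
    { toFun := N
      map_mul' := fun s t => by
        have h : s * t = φ (num s * num t) / φ (den s * den t) := by
          conv_lhs => rw [hnd s, hnd t]
          rw [map_mul, map_mul, div_mul_div_comm]
        rw [h, hN _ _ (by rw [map_mul]; exact mul_ne_zero (hden _) (hden _)), map_mul, map_mul,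
          ← div_mul_div_comm]
      nonneg' := fun s => div_nonneg (apply_nonneg z _) (apply_nonneg z _)
      eq_zero' := fun s => by
        constructor
        · intro h
          rcases div_eq_zero_iff.mp h with h | h
          · rw [hnd s, (hφ _).2 h, zero_div]
          · exact absurd ((hφ _).2 h) (hden s)
        · rintro rfl
          have h : (0 : K) = φ 0 / φ 1 := by simp
          rw [h, hN _ _ (by simp), z0, zero_div]
      add_le' := fun s t => by
        have h : s + t = φ (num s * den t + den s * num t) / φ (den s * den t) := by
          conv_lhs => rw [hnd s, hnd t]
          rw [map_add, map_mul, map_mul, map_mul, div_add_div _ _ (hden s) (hden t)]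
        rw [h, hN _ _ (by rw [map_mul]; exact mul_ne_zero (hden _) (hden _))]
        change _ ≤ z (num s) / z (den s) + z (num t) / z (den t)
        rw [div_add_div _ _ (hpos _ (hden s)).ne' (hpos _ (hden t)).ne', map_mul]
        gcongr
        exact (map_add_le_add z _ _).trans_eq (by simp only [map_mul]) }
  refine ⟨K, v.toNormedField, φ, fun r => ?_, fun w => ⟨num w, den w, hden w, hnd w⟩⟩
  change N (φ r) = z r
  have := hN r 1 (by simp)
  simpa using this

/-! ### Gauss points and restriction of scalars -/

namespace BerkovichLine

instance instMulRingSeminormClass {k : Type u} [NormedField k] :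
    MulRingSeminormClass (BerkovichLine k) k[X] ℝ where
  map_add_le_add x := map_add_le_add x.toMulRingSeminorm
  map_zero x := map_zero x.toMulRingSeminorm
  map_neg_eq_map x := map_neg_eq_map x.toMulRingSeminorm
  map_mul x := map_mul x.toMulRingSeminorm
  map_one x := map_one x.toMulRingSeminorm

section
variable {k : Type u} [NormedField k]

@[simp]
theorem apply_C (x : BerkovichLine k) (a : k) : x (C a) = ‖a‖ := x.map_C' a

theorem nonneg (x : BerkovichLine k) (f : k[X]) : 0 ≤ x f := apply_nonneg x f

theorem apply_C_mul (x : BerkovichLine k) (a : k) (f : k[X]) : x (C a * f) = ‖a‖ * x f := by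
  rw [map_mul, apply_C]

/-- Every point is induced by a homomorphism to an ultrametric field generated by the image. -/
theorem exists_residueField [IsUltrametricDist k] (x : BerkovichLine k) :
    ∃ (K : Type u) (_ : NormedField K) (_ : IsUltrametricDist K) (φ : k[X] →+* K),
      (∀ f, ‖φ f‖ = x f) ∧ ∀ w, ∃ a b, φ b ≠ 0 ∧ w = φ a / φ b := by
  obtain ⟨K, hK, φ, hφ, hfrac⟩ := x.toMulRingSeminorm.exists_normedField
  refine ⟨K, hK, IsUltrametricDist.isUltrametricDist_of_forall_norm_natCast_le_one fun n => ?_,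
    φ, hφ, hfrac⟩
  have h1 : φ (C (n : k)) = n := by simp
  rw [← h1, hφ]
  exact (x.map_C' n).trans_le (IsUltrametricDist.norm_natCast_le_one k n)

variable [IsUltrametricDist k]

theorem isNonarchimedean (x : BerkovichLine k) : IsNonarchimedean x := by
  intro f g
  obtain ⟨K, hK, hu, φ, hφ, -⟩ := x.exists_residueField
  rw [← hφ, ← hφ, ← hφ, map_add]
  exact IsUltrametricDist.norm_add_le_max _ _

theorem add_le_max (x : BerkovichLine k) (f g : k[X]) : x (f + g) ≤ max (x f) (x g) :=
  x.isNonarchimedean f g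

theorem sub_le_max (x : BerkovichLine k) (f g : k[X]) : x (f - g) ≤ max (x f) (x g) := by
  rw [sub_eq_add_neg, ← map_neg_eq_map x g]
  exact x.add_le_max _ _

/-- The maximal point of the disc of centre `α` and radius `ρ`. -/
noncomputable def gauss (α : k) (ρ : ℝ≥0) : BerkovichLine k where
  toFun f := (taylor α f).gaussNorm (NormedField.toAbsoluteValue k) ρ
  map_zero' := by simp
  add_le' f g := by
    rw [map_add]
    exact (isNonarchimedean_gaussNorm (NormedField.toAbsoluteValue k)
      IsUltrametricDist.isNonarchimedean_norm ρ.2).add_le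
        (fun p => p.gaussNorm_nonneg _ ρ.2)
  neg' f := by
    rw [map_neg]
    simp only [gaussNorm, support_neg, coeff_neg, map_neg_eq_map]
  map_one' := by
    rw [← C_1, taylor_C, gaussNorm_C]
    simp
  map_mul' f g := by
    rw [taylor_mul]
    rcases ρ.2.eq_or_lt with h | h
    · rw [← NNReal.val_eq_coe, ← h]
      simp only [gaussNorm_zero_right, mul_coeff_zero, map_mul]
    · exact gaussNorm_mul IsUltrametricDist.isNonarchimedean_norm h _ _
  map_C' a := by simp; rfl

theorem gauss_apply (α : k) (ρ : ℝ≥0) (f : k[X]) :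
    gauss α ρ f = (taylor α f).gaussNorm (NormedField.toAbsoluteValue k) ρ := rfl

theorem le_gauss (α : k) (ρ : ℝ≥0) (f : k[X]) (i : ℕ) :
    ‖(taylor α f).coeff i‖ * ρ ^ i ≤ gauss α ρ f :=
  (taylor α f).le_gaussNorm (NormedField.toAbsoluteValue k) ρ.2 i

theorem exists_gauss_eq (α : k) (ρ : ℝ≥0) (f : k[X]) :
    ∃ i, gauss α ρ f = ‖(taylor α f).coeff i‖ * ρ ^ i :=
  (taylor α f).exists_eq_gaussNorm (NormedField.toAbsoluteValue k) ρ

theorem gauss_zero (α : k) (f : k[X]) : gauss α 0 f = ‖f.eval α‖ := by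
  rw [gauss_apply, NNReal.coe_zero, gaussNorm_zero_right, taylor_coeff_zero]
  rfl

theorem norm_eval_le_gauss (α : k) (ρ : ℝ≥0) (f : k[X]) : ‖f.eval α‖ ≤ gauss α ρ f := by
  simpa using le_gauss α ρ f 0

theorem gauss_X_sub_C_self (α : k) (ρ : ℝ≥0) : gauss α ρ (X - C α) = ρ := by
  simp only [gauss_apply, map_sub, taylor_X, taylor_C, add_sub_cancel_right]
  rw [← monomial_one_one_eq_X, gaussNorm_monomial]
  simp

/-- In the Taylor expansion at `α`, each term is at most the corresponding term of the Gauss norm at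
any point of the disc; the ultrametric inequality concludes. -/
theorem isGreatest_gauss (α : k) (ρ : ℝ≥0) : IsGreatest (disc (X - C α) ρ) (gauss α ρ) := by
  refine ⟨(gauss_X_sub_C_self α ρ).le, fun z hz f => ?_⟩
  have hz : z (X - C α) ≤ ρ := hz
  have key : ∀ i, z (C ((taylor α f).coeff i) * (X - C α) ^ i) ≤ gauss α ρ f := fun i => by
    rw [apply_C_mul, map_pow]
    refine le_trans ?_ (le_gauss α ρ f i)
    gcongr
  obtain ⟨b, -, hb⟩ := IsNonarchimedean.finset_image_add (map_zero z) z.nonneg z.isNonarchimedean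
    (fun i => C ((taylor α f).coeff i) * (X - C α) ^ i) (taylor α f).support
  have hf : f = ∑ i ∈ (taylor α f).support, C ((taylor α f).coeff i) * (X - C α) ^ i :=
    (sum_taylor_eq f α).symm
  exact (congrArg z hf).trans_le (hb.trans (key b))

theorem gauss_mono (α : k) {ρ σ : ℝ≥0} (h : ρ ≤ σ) : gauss α ρ ≤ gauss α σ :=
  (isGreatest_gauss α σ).2 ((gauss_X_sub_C_self α ρ).trans_le (NNReal.coe_le_coe.2 h))

theorem gauss_X_sub_C (α β : k) (ρ : ℝ≥0) : gauss α ρ (X - C β) = max (ρ : ℝ) ‖α - β‖ := by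
  have h : X - C β = (X - C α) + C (α - β) := by rw [map_sub]; ring
  apply le_antisymm
  · rw [h]
    refine (add_le_max _ _ _).trans_eq ?_
    rw [gauss_X_sub_C_self, apply_C]
  · have h1 : ‖α - β‖ ≤ gauss α ρ (X - C β) := by
      have h2 := norm_eval_le_gauss α ρ (X - C β)
      rwa [eval_sub, eval_X, eval_C] at h2
    have h2 := le_gauss α ρ (X - C β) 1
    simp only [map_sub, taylor_X, taylor_C, coeff_sub, coeff_add, coeff_X_one, coeff_C_succ,
      add_zero, sub_zero, norm_one, one_mul, pow_one] at h2
    exact max_le h2 h1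

theorem gauss_le_gauss {α β : k} {ρ σ : ℝ≥0} (h : ρ ≤ σ) (hαβ : ‖α - β‖ ≤ σ) :
    gauss α ρ ≤ gauss β σ := by
  apply (isGreatest_gauss β σ).2
  change gauss α ρ (X - C β) ≤ σ
  rw [gauss_X_sub_C]
  exact max_le (NNReal.coe_le_coe.2 h) hαβ

theorem gauss_eq_gauss {α β : k} {ρ : ℝ≥0} (hαβ : ‖α - β‖ ≤ ρ) : gauss α ρ = gauss β ρ :=
  le_antisymm (gauss_le_gauss le_rfl hαβ) (gauss_le_gauss le_rfl (by rwa [norm_sub_rev]))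

end

/-- Restriction of a point along an isometric embedding of fields. -/
noncomputable def comap {k Ω : Type u} [NormedField k] [NormedField Ω] (ι : k →+* Ω)
    (hι : ∀ a, ‖ι a‖ = ‖a‖) (z : BerkovichLine Ω) : BerkovichLine k where
  toFun f := z (f.map ι)
  map_zero' := by simp
  add_le' f g := by simpa using map_add_le_add z _ _
  neg' f := by simp
  map_one' := by simp
  map_mul' f g := by simp
  map_C' a := by simp [hι]

theorem comap_apply {k Ω : Type u} [NormedField k] [NormedField Ω] (ι : k →+* Ω)
    (hι : ∀ a, ‖ι a‖ = ‖a‖) (z : BerkovichLine Ω) (f : k[X]) : comap ι hι z f = z (f.map ι) := rfl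

theorem comap_mono {k Ω : Type u} [NormedField k] [NormedField Ω] (ι : k →+* Ω)
    (hι : ∀ a, ‖ι a‖ = ‖a‖) {y z : BerkovichLine Ω} (h : y ≤ z) :
    comap ι hι y ≤ comap ι hι z := fun f => h (f.map ι)

end BerkovichLine

/-! ### Elements close to constants and immediate extensions -/

theorem norm_eq_of_norm_sub_lt_right {K : Type*} [NormedField K] [IsUltrametricDist K] {a c : K}
    (h : ‖a - c‖ < ‖c‖) : ‖a‖ = ‖c‖ := by
  have h1 := IsUltrametricDist.norm_add_eq_max_of_norm_ne_norm h.ne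
  rwa [sub_add_cancel, max_eq_right h.le] at h1

theorem Polynomial.mod_mod_self {K : Type*} [Field K] (f P : K[X]) : f % P % P = f % P := by
  by_cases h : P = 0
  · rw [h, EuclideanDomain.mod_zero]
  · exact (mod_eq_self_iff h).2 (EuclideanDomain.mod_lt f h)

/-- An extension in which every nonzero element is close to a constant is immediate. -/
theorem MaximallyComplete.surjective_of_forall_exists_norm_sub_lt {k K : Type u} [NormedField k]
    [NormedField K] [IsUltrametricDist K] (hk : MaximallyComplete k) (ι : k →+* K)
    (hι : ∀ a, ‖ι a‖ = ‖a‖) (h : ∀ w, w ≠ 0 → ∃ c, ‖w - ι c‖ < ‖ι c‖) :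
    Function.Surjective ι := by
  let _ : NormedAlgebra k K :=
    { ι.toAlgebra with
      norm_smul_le := fun a w => by
        change ‖ι a * w‖ ≤ _
        rw [norm_mul, hι] }
  have hnorm : ∀ w c, ‖w - ι c‖ < ‖ι c‖ → ‖c‖ = ‖w‖ := fun w c hc => by
    rw [← hι, norm_eq_of_norm_sub_lt_right hc]
  refine hk K (fun w hw => ?_) fun w hw => ?_
  · obtain ⟨c, hc⟩ := h w hw
    refine ⟨c, ?_, hnorm w c hc⟩
    rintro rfl
    simp only [map_zero, norm_zero] at hc
    exact (norm_nonneg _).not_gt hc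
  · by_cases hw0 : w = 0
    · exact ⟨0, by simp, by simp [hw0]⟩
    · obtain ⟨c, hc⟩ := h w hw0
      have := hnorm w c hc
      refine ⟨c, this.trans_le hw, ?_⟩
      exact hc.trans_le (by rw [hι, this]; exact hw)

theorem norm_div_sub_div_lt {K : Type*} [NormedField K] [IsUltrametricDist K] {a b c d : K}
    (hac : ‖a - c‖ < ‖c‖) (hbd : ‖b - d‖ < ‖d‖) : ‖a / b - c / d‖ < ‖c / d‖ := by
  have hb : ‖b‖ = ‖d‖ := norm_eq_of_norm_sub_lt_right hbd
  have hd : 0 < ‖d‖ := (norm_nonneg _).trans_lt hbd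
  have hc : 0 < ‖c‖ := (norm_nonneg _).trans_lt hac
  have hd0 : d ≠ 0 := norm_pos_iff.1 hd
  have hb0 : b ≠ 0 := norm_pos_iff.1 (hb ▸ hd)
  have h : a / b - c / d = ((a - c) * d - c * (b - d)) / (b * d) := by
    field_simp
    ring
  rw [h, norm_div, norm_div, norm_mul, hb, div_lt_div_iff₀ (by positivity) hd]
  have : ‖(a - c) * d - c * (b - d)‖ < ‖c‖ * ‖d‖ := by
    rw [sub_eq_add_neg]
    refine (IsUltrametricDist.norm_add_le_max _ _).trans_lt (max_lt ?_ ?_)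
    · rw [norm_mul]
      gcongr
    · rw [norm_neg, norm_mul]
      gcongr
  calc _ < ‖c‖ * ‖d‖ * ‖d‖ := by gcongr
    _ = _ := by ring

namespace BerkovichLine

variable {k : Type u} [NormedField k] [IsUltrametricDist k]

theorem apply_add_eq_max (x : BerkovichLine k) {f g : k[X]} (h : x f ≠ x g) :
    x (f + g) = max (x f) (x g) :=
  x.isNonarchimedean.add_eq_max_of_ne h

theorem apply_sub_eq_max (x : BerkovichLine k) {f g : k[X]} (h : x f ≠ x g) :
    x (f - g) = max (x f) (x g) := by
  rw [sub_eq_add_neg, ← map_neg_eq_map x g]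
  exact x.apply_add_eq_max (by rwa [map_neg_eq_map])

/-- The polynomial `f` is asymptotic at `y` to the constant `c`. -/
def IsNearConst (y : BerkovichLine k) (f : k[X]) (c : k) : Prop :=
  y (f - C c) < ‖c‖

omit [IsUltrametricDist k] in
theorem IsNearConst.mono {y z : BerkovichLine k} {f : k[X]} {c : k} (h : y.IsNearConst f c)
    (hzy : z ≤ y) : z.IsNearConst f c :=
  (hzy _).trans_lt h

theorem IsNearConst.apply_eq {y : BerkovichLine k} {f : k[X]} {c : k} (h : y.IsNearConst f c) :
    y f = ‖c‖ := by
  have h1 : y (f - C c + C c) = _ := y.apply_add_eq_max (by rw [apply_C]; exact ne_of_lt h)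
  rwa [sub_add_cancel, apply_C, max_eq_right (le_of_lt h)] at h1

omit [IsUltrametricDist k] in
theorem IsNearConst.pos {y : BerkovichLine k} {f : k[X]} {c : k} (h : y.IsNearConst f c) :
    0 < ‖c‖ := (y.nonneg _).trans_lt h

theorem IsNearConst.mul {y : BerkovichLine k} {f g : k[X]} {c d : k} (hf : y.IsNearConst f c)
    (hg : y.IsNearConst g d) : y.IsNearConst (f * g) (c * d) := by
  have h : f * g - C (c * d) = (f - C c) * g + C c * (g - C d) := by
    rw [map_mul]; ring
  unfold IsNearConst
  rw [h, norm_mul]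
  refine (y.add_le_max _ _).trans_lt (max_lt ?_ ?_)
  · rw [map_mul, hg.apply_eq]
    exact mul_lt_mul_of_pos_right hf hg.pos
  · rw [apply_C_mul]
    exact mul_lt_mul_of_pos_left hg hf.pos

omit [IsUltrametricDist k] in
theorem isNearConst_C (y : BerkovichLine k) {c : k} (hc : c ≠ 0) : y.IsNearConst (C c) c := by
  simpa [IsNearConst] using hc

/-- Shrinking the radius contracts the non-constant part of a polynomial. -/
theorem gauss_sub_eval_mul_le (α : k) {ρ σ : ℝ≥0} (h : ρ ≤ σ) (f : k[X]) :
    gauss α ρ (f - C (f.eval α)) * σ ≤ ρ * gauss α σ f := by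
  obtain ⟨i, hi⟩ := exists_gauss_eq α ρ (f - C (f.eval α))
  rw [hi, map_sub, taylor_C, coeff_sub]
  rcases i with _ | j
  · rw [taylor_coeff_zero, coeff_C_zero, sub_self, norm_zero, zero_mul, zero_mul]
    exact mul_nonneg ρ.2 (nonneg _ _)
  · rw [coeff_C_succ, sub_zero]
    calc ‖(taylor α f).coeff (j + 1)‖ * (ρ : ℝ) ^ (j + 1) * σ
        = ρ * (‖(taylor α f).coeff (j + 1)‖ * ((ρ : ℝ) ^ j * σ)) := by ring
      _ ≤ ρ * (‖(taylor α f).coeff (j + 1)‖ * ((σ : ℝ) ^ j * σ)) := by gcongr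
      _ ≤ ρ * gauss α σ f := by
        rw [← pow_succ]
        gcongr
        exact le_gauss α σ f (j + 1)

theorem gauss_pos (α : k) {ρ : ℝ≥0} (hρ : 0 < ρ) {f : k[X]} (hf : f ≠ 0) : 0 < gauss α ρ f := by
  have h : 0 < ‖(taylor α f).coeff f.natDegree‖ * (ρ : ℝ) ^ f.natDegree := by
    rw [coeff_taylor_natDegree]
    have := norm_pos_iff.2 (leadingCoeff_ne_zero.2 hf)
    positivity
  exact h.trans_le (le_gauss _ _ _ _)

/-! ### Limits of decreasing sequences of points -/

section Kaplansky

variable {y : ℕ → BerkovichLine k} (hy : Antitone y)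

/-- The polynomial `f` is asymptotic to a constant far along the sequence `y`. -/
def IsStable (y : ℕ → BerkovichLine k) (f : k[X]) : Prop :=
  ∃ n c, (y n).IsNearConst f c

include hy in
theorem IsStable.mul {f g : k[X]} (hf : IsStable y f) (hg : IsStable y g) :
    IsStable y (f * g) := by
  obtain ⟨n, c, hc⟩ := hf
  obtain ⟨m, d, hd⟩ := hg
  exact ⟨max n m, c * d, (hc.mono (hy (le_max_left _ _))).mul (hd.mono (hy (le_max_right _ _)))⟩

omit [IsUltrametricDist k] in
theorem iInf_le_apply (y : ℕ → BerkovichLine k) (f : k[X]) (n : ℕ) : ⨅ m, y m f ≤ y n f :=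
  ciInf_le ⟨0, by rintro _ ⟨m, rfl⟩; exact nonneg _ _⟩ n

include hy in
theorem exists_forall_apply_eq_iInf {f : k[X]} (hf : f ≠ 0 → IsStable y f) :
    ∃ n, ∀ m, n ≤ m → y m f = ⨅ m, y m f := by
  by_cases h0 : f = 0
  · exact ⟨0, by simp [h0]⟩
  · obtain ⟨n, c, hc⟩ := hf h0
    have h : ∀ m, n ≤ m → y m f = ‖c‖ := fun m hm => (hc.mono (hy hm)).apply_eq
    refine ⟨n, fun m hm => le_antisymm (le_ciInf fun l => ?_) (iInf_le_apply y f m)⟩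
    rw [h m hm, ← h (max n l) (le_max_left _ _)]
    exact hy (le_max_right n l) f

/-- The limit of a decreasing sequence of points `y`, taken modulo a polynomial `P` which is zero
or of minimal degree among those that are not asymptotic to constants. -/
theorem exists_limit (hy : Antitone y) (P : k[X])
    (hP : P ≠ 0 → ∀ n, y (n + 1) P < y n P)
    (hP' : ∀ f, f % P = f → f ≠ 0 → IsStable y f) :
    ∃ z : BerkovichLine k, (∀ f, z f = ⨅ n, y n (f % P)) ∧ ∀ a : k, C a % P = C a := by
  have hmod : ∀ f, f % P % P = f % P := fun f => mod_mod_self f P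
  have hC : ∀ a : k, C a % P = C a := fun a => by
    by_cases h0 : P = 0
    · rw [h0, EuclideanDomain.mod_zero]
    · rw [mod_eq_self_iff h0]
      refine degree_C_le.trans_lt (not_le.1 fun h => ?_)
      have := hP h0 0
      rw [eq_C_of_degree_le_zero h, apply_C, apply_C] at this
      exact lt_irrefl _ this
  have hst : ∀ f, ∃ n, ∀ m, n ≤ m → y m (f % P) = ⨅ m, y m (f % P) := fun f =>
    exists_forall_apply_eq_iInf hy (hP' _ (hmod f))
  have hzero : (⨅ n, y n ((0 : k[X]) % P)) = 0 := by
    rw [← C_0, hC]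
    simp
  have hadd : ∀ f g, ⨅ n, y n ((f + g) % P) ≤ (⨅ n, y n (f % P)) + ⨅ n, y n (g % P) := by
    intro f g
    obtain ⟨n, hn⟩ := hst f
    obtain ⟨m, hm⟩ := hst g
    rw [← hn _ (le_max_left n m), ← hm _ (le_max_right n m), Polynomial.add_mod]
    exact (iInf_le_apply _ _ (max n m)).trans (map_add_le_add _ _ _)
  have hneg : ∀ f, ⨅ n, y n (-f % P) = ⨅ n, y n (f % P) := fun f => by
    have h : -f % P = -(f % P) := by
      rw [← zero_sub, sub_mod, ← C_0, hC, C_0, zero_sub]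
    simp only [h, map_neg_eq_map]
  have hone : ⨅ n, y n (1 % P) = 1 := by
    rw [← C_1, hC]
    simp
  have hmul : ∀ f g, ⨅ n, y n (f * g % P) = (⨅ n, y n (f % P)) * ⨅ n, y n (g % P) := by
    intro f g
    set f₁ := f % P with hf₁
    set g₁ := g % P with hg₁
    have hs : f * g % P = f₁ * g₁ % P := Polynomial.mul_mod f g P
    set q := f₁ * g₁ / P with hq
    -- The quotient also has degree less than that of `P`, because a product of two remainders has
    -- degree less than twice that of `P`. Its values are therefore eventually constant.
    have hq' : ∃ n, ∀ m, n ≤ m → y m q = ⨅ m, y m q := by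
      refine exists_forall_apply_eq_iInf hy fun hq0 => hP' _ ?_ hq0
      by_cases h0 : P = 0
      · exact absurd (by rw [hq, h0, EuclideanDomain.div_zero]) hq0
      · rw [mod_eq_self_iff h0]
        have h1 : degree f₁ < degree P := EuclideanDomain.mod_lt f h0
        have h2 : degree g₁ < degree P := EuclideanDomain.mod_lt g h0
        have h3 : P * q + f₁ * g₁ % P = f₁ * g₁ := EuclideanDomain.div_add_mod _ _
        by_contra h4
        rw [not_lt] at h4
        have h5 : degree (f₁ * g₁ % P) < degree (P * q) := by
          refine (EuclideanDomain.mod_lt _ h0).trans_le ?_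
          rw [degree_mul]
          calc degree P = degree P + 0 := (add_zero _).symm
            _ ≤ degree P + degree q := by
              gcongr
              exact zero_le_degree_iff.2 hq0
        have h6 := degree_add_eq_left_of_degree_lt h5
        rw [h3, degree_mul, degree_mul] at h6
        have h7 : degree f₁ + degree g₁ < degree P + degree P := by
          have hf0 : f₁ ≠ 0 := fun h => hq0 (by rw [hq, h, zero_mul, EuclideanDomain.zero_div])
          have hg0 : g₁ ≠ 0 := fun h => hq0 (by rw [hq, h, mul_zero, EuclideanDomain.zero_div])
          rw [degree_eq_natDegree hf0, degree_eq_natDegree h0] at h1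
          rw [degree_eq_natDegree hg0, degree_eq_natDegree h0] at h2
          rw [degree_eq_natDegree hf0, degree_eq_natDegree hg0, degree_eq_natDegree h0]
          norm_cast at *
          omega
        rw [h6] at h7
        exact absurd h7 (not_lt.2 (by gcongr))
    obtain ⟨n₁, h₁⟩ := hst f
    obtain ⟨n₂, h₂⟩ := hst g
    obtain ⟨n₃, h₃⟩ := hst (f * g)
    obtain ⟨n₄, h₄⟩ := hq'
    let n := max (max n₁ n₂) (max n₃ n₄)
    have key : ∀ m, n ≤ m → y m P * ⨅ m, y m q =
        y m (f₁ * g₁ - f * g % P) := fun m hm => by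
      rw [← h₄ m (by omega), ← map_mul, hs]
      congr 1
      rw [eq_sub_iff_add_eq]
      exact EuclideanDomain.div_add_mod _ _
    -- If the values of `f₁ * g₁` and of its remainder had different limits, the value of their
    -- difference `P * q` would eventually be their maximum, a positive constant. But `y m q` is
    -- eventually constant and `y m P` strictly decreases.
    by_contra hne
    have hmax : ∀ m, n ≤ m → y m P * ⨅ m, y m q =
        max ((⨅ n, y n f₁) * ⨅ n, y n g₁) (⨅ n, y n (f * g % P)) := fun m hm => by
      rw [key m hm, apply_sub_eq_max, map_mul, h₁ m (by omega), h₂ m (by omega),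
        h₃ m (by omega)]
      rw [map_mul, h₁ m (by omega), h₂ m (by omega), h₃ m (by omega)]
      exact fun h => hne h.symm
    have hnn : ∀ f, 0 ≤ ⨅ n, y n f := fun f => le_ciInf fun n => nonneg _ _
    have hpos : 0 < max ((⨅ n, y n f₁) * ⨅ n, y n g₁) (⨅ n, y n (f * g % P)) := by
      rcases lt_or_gt_of_ne hne with h | h
      · exact lt_max_of_lt_left ((hnn _).trans_lt h)
      · exact lt_max_of_lt_right ((mul_nonneg (hnn _) (hnn _)).trans_lt h)
    have hq0 : (⨅ m, y m q) ≠ 0 := fun h => by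
      rw [← hmax n le_rfl, h, mul_zero] at hpos
      exact lt_irrefl _ hpos
    have h := (hmax n le_rfl).trans (hmax (n + 1) (by omega)).symm
    have h := mul_right_cancel₀ hq0 h
    by_cases h0 : P = 0
    · rw [← hmax n le_rfl, h0, map_zero, zero_mul] at hpos
      exact lt_irrefl _ hpos
    · exact (hP h0 n).ne' h
  refine ⟨⟨⟨⟨fun f => ⨅ n, y n (f % P), hzero, hadd, hneg⟩, hone, hmul⟩, fun a => ?_⟩,
    fun f => rfl, hC⟩
  change (⨅ n, y n (C a % P)) = _
  rw [hC]
  simp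

end Kaplansky

/-! ### Maximal completeness implies spherical completeness -/

/-- A maximally complete field is spherically complete. -/
theorem _root_.MaximallyComplete.exists_forall_norm_sub_le (hk : MaximallyComplete k) {a : ℕ → k}
    {r : ℕ → ℝ≥0} (hr : StrictAnti r) (ha : ∀ n m, n ≤ m → ‖a m - a n‖ ≤ r n) :
    ∃ c, ∀ n, ‖c - a n‖ ≤ r n := by
  by_contra! hcon
  let y : ℕ → BerkovichLine k := fun n => gauss (a n) (r n)
  have hy : Antitone y := fun n m h => gauss_le_gauss (hr.antitone h) (ha n m h)
  have hr0 : ∀ n, 0 < r n := fun n => pos_of_gt (hr (Nat.lt_succ_self n))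
  have hlin : ∀ c, IsStable y (X - C c) := fun c => by
    obtain ⟨n, hn⟩ := hcon c
    refine ⟨n, a n - c, ?_⟩
    have h : X - C c - C (a n - c) = X - C (a n) := by rw [map_sub]; ring
    change y n _ < _
    rw [h, norm_sub_rev]
    exact (gauss_X_sub_C_self _ _).trans_lt hn
  have hconst : ∀ c, c ≠ 0 → IsStable y (C c) := fun c hc => ⟨0, c, isNearConst_C _ hc⟩
  -- For an unstable `f`, the constant term at the new centre never dominates, so `y (n + 1) f` is
  -- bounded by the non-constant part, which shrinks by the factor `r (n + 1) / r n`.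
  have hdec : ∀ f, f ≠ 0 → ¬ IsStable y f → ∀ n, y (n + 1) f < y n f := by
    intro f hf hs n
    set c := f.eval (a (n + 1)) with hc
    have h1 : ‖c‖ ≤ y (n + 1) (f - C c) := not_lt.1 fun h => hs ⟨n + 1, c, h⟩
    have h2 : y (n + 1) f ≤ y (n + 1) (f - C c) := by
      have := (y (n + 1)).add_le_max (f - C c) (C c)
      rwa [sub_add_cancel, apply_C, max_eq_left h1] at this
    have h3 := gauss_sub_eval_mul_le (a (n + 1)) (hr (Nat.lt_succ_self n)).le f
    have h4 : gauss (a (n + 1)) (r n) = y n := gauss_eq_gauss (ha n (n + 1) (Nat.le_succ n))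
    rw [h4] at h3
    have h5 : 0 < y n f := gauss_pos _ (hr0 n) hf
    have h6 : (r (n + 1) : ℝ) < r n := hr (Nat.lt_succ_self n)
    have h7 : (0 : ℝ) < r n := hr0 n
    refine h2.trans_lt (lt_of_mul_lt_mul_right ?_ h7.le)
    calc _ ≤ (r (n + 1) : ℝ) * y n f := h3
      _ < r n * y n f := by gcongr
      _ = _ := mul_comm _ _
  -- An unstable polynomial of minimal degree, or `0` if every nonzero polynomial is stable;
  -- remainders modulo `0` are the polynomials themselves.
  obtain ⟨P, hP, hP'⟩ : ∃ P : k[X], (P ≠ 0 → ¬ IsStable y P) ∧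
      ∀ f, f % P = f → f ≠ 0 → IsStable y f := by
    by_cases hall : ∀ f : k[X], f ≠ 0 → IsStable y f
    · exact ⟨0, fun h => absurd rfl h, fun f _ => hall f⟩
    · push Not at hall
      obtain ⟨P, ⟨hP0, hP⟩, hmin⟩ := degree_lt_wf.has_min {f : k[X] | f ≠ 0 ∧ ¬ IsStable y f} hall
      refine ⟨P, fun _ => hP, fun f hf hf0 => by_contra fun hs => ?_⟩
      exact hmin f ⟨hf0, hs⟩ ((mod_eq_self_iff hP0).1 hf)
  obtain ⟨z, hz, hC⟩ := exists_limit hy P (fun h => hdec P h (hP h)) hP'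
  have hzP : ∀ f, z (f - f % P) = 0 := fun f => by
    rw [hz, sub_mod, mod_mod_self, sub_self]
    simp
  have hzC : ∀ (f : k[X]) (c : k), z (f % P - C c) ≤ ⨅ n, y n (f % P - C c) := fun f c => by
    rw [hz, sub_mod, mod_mod_self, hC]
  obtain ⟨K, _, _, φ, hφ, hfrac⟩ := z.exists_residueField
  have hφmod : ∀ f, φ f = φ (f % P) := fun f => by
    rw [← sub_eq_zero, ← map_sub, ← norm_eq_zero, hφ, hzP]
  -- Nonzero elements of the image are classes of stable remainders, hence close to constants; so
  -- are their quotients. The residue field of `z` is thus immediate over `k`, hence equal to it.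
  have happrox : ∀ f, φ f ≠ 0 → ∃ c, ‖φ f - φ (C c)‖ < ‖φ (C c)‖ := fun f hf => by
    have h0 : f % P ≠ 0 := fun h => hf (by rw [hφmod, h, map_zero])
    obtain ⟨n, c, hc⟩ := hP' (f % P) (mod_mod_self _ _) h0
    refine ⟨c, ?_⟩
    rw [hφmod, ← map_sub, hφ, hφ, apply_C]
    exact ((hzC f c).trans (iInf_le_apply _ _ n)).trans_lt hc
  obtain ⟨c, hc⟩ := hk.surjective_of_forall_exists_norm_sub_lt (φ.comp C)
    (fun a => by rw [RingHom.comp_apply, hφ, apply_C]) (fun w hw => by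
      obtain ⟨f, g, hg, rfl⟩ := hfrac w
      obtain ⟨c, hc⟩ := happrox f fun h => hw (by rw [h, zero_div])
      obtain ⟨d, hd⟩ := happrox g hg
      refine ⟨c / d, ?_⟩
      rw [map_div₀]
      exact norm_div_sub_div_lt hc hd) (φ X)
  have hker : φ (X - C c) = 0 := by
    rw [map_sub, ← hc, RingHom.comp_apply, sub_self]
  -- A nonzero remainder is stable, so it does not vanish at `z`; but `X - C c` does. Hence `P` is
  -- constant or associated to `X - C c`, and both are stable since `c` is not in all the discs.
  have hdvd : P ∣ X - C c := by
    rw [← EuclideanDomain.mod_eq_zero]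
    by_contra h0
    obtain ⟨n, d, hd⟩ := hP' _ (mod_mod_self _ _) h0
    have h1 := (hzC (X - C c) d).trans_lt ((iInf_le_apply _ _ n).trans_lt hd)
    have h2 : z ((X - C c) % P) = ‖d‖ := IsNearConst.apply_eq h1
    rw [← hφ, ← hφmod, hker, norm_zero] at h2
    exact hd.pos.ne h2
  have hP0 : P ≠ 0 := ne_zero_of_dvd_ne_zero (X_sub_C_ne_zero c) hdvd
  apply hP hP0
  rcases (irreducible_X_sub_C c).dvd_iff.1 hdvd with h | h
  · obtain ⟨e, he, rfl⟩ := isUnit_iff.1 h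
    exact hconst e he.ne_zero
  · obtain ⟨e, rfl⟩ := h
    obtain ⟨e', he', h⟩ := isUnit_iff.1 e.isUnit
    rw [← h]
    exact (hlin c).mul hy (hconst e' he'.ne_zero)

end BerkovichLine

/-! ### Minimal monic polynomials -/

namespace BerkovichLine

variable {k : Type u} [NormedField k]

theorem _root_.Polynomial.degree_sub_C_coeff_mul_lt {R : Type*} [Ring R] {n : ℕ} {f P : R[X]}
    (hf : degree f < (n + 1 : ℕ)) (hP : P.Monic) (hPn : P.natDegree = n) :
    degree (f - C (f.coeff n) * P) < n := by
  rw [degree_lt_iff_coeff_zero] at hf ⊢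
  intro m hm
  rw [coeff_sub, coeff_C_mul]
  rcases hm.eq_or_lt with rfl | h
  · have : P.coeff n = 1 := by rw [← hPn]; exact hP
    rw [this, mul_one, sub_self]
  · have : P.coeff m = 0 := coeff_eq_zero_of_natDegree_lt (by omega)
    rw [hf m h, this, mul_zero, sub_zero]

section

variable [IsUltrametricDist k]

omit [IsUltrametricDist k] in
theorem norm_mul_le_of_forall_le {x : BerkovichLine k} {P : k[X]} {n : ℕ}
    (h : ∀ f, degree f < n → x P ≤ x (P + f)) (c : k) {f : k[X]} (hf : degree f < n) :
    ‖c‖ * x P ≤ x (C c * P + f) := by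
  by_cases hc : c = 0
  · simp [hc]
  · have h1 : C c * P + f = C c * (P + C c⁻¹ * f) := by
      rw [mul_add, ← mul_assoc, ← C_mul, mul_inv_cancel₀ hc, C_1, one_mul]
    rw [h1, apply_C_mul]
    gcongr
    exact h _ (by rwa [degree_C_mul (inv_ne_zero hc)])

/-- The polynomials of degree less than `n` are spherically complete with respect to `x`. -/
def SphericallyCompleteBelow (x : BerkovichLine k) (n : ℕ) : Prop :=
  ∀ (f : ℕ → k[X]) (r : ℕ → ℝ≥0), StrictAnti r → (∀ i, degree (f i) < n) →
    (∀ i j, i ≤ j → x (f j - f i) ≤ r i) → ∃ g, degree g < n ∧ ∀ i, x (g - f i) ≤ r i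

/-- If the infimum of the values of monic polynomials of degree `n` were not attained, a minimising
sequence would define nested balls of polynomials of lower degree; a common point attains the
infimum. -/
theorem SphericallyCompleteBelow.exists_minimal {x : BerkovichLine k} {n : ℕ}
    (hx : x.SphericallyCompleteBelow n) :
    ∃ P : k[X], P.Monic ∧ P.natDegree = n ∧ ∀ f, degree f < n → x P ≤ x (P + f) := by
  let S : Set ℝ := {s | ∃ f : k[X], degree f < n ∧ x (X ^ n + f) = s}
  have hbdd : BddBelow S := ⟨0, by rintro _ ⟨f, -, rfl⟩; exact nonneg _ _⟩
  have hne : S.Nonempty := ⟨_, 0, by simp, rfl⟩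
  have hglb := isGLB_csInf hne hbdd
  have hmem : sInf S ∈ S := by
    by_contra hS
    obtain ⟨u, hu, hlt, htend, hmem⟩ := hglb.exists_seq_strictAnti_tendsto_of_notMem hS hne
    choose f hf hfu using hmem
    have hu0 : ∀ i, 0 ≤ u i := fun i => by rw [← hfu]; exact nonneg _ _
    obtain ⟨g, hg, hgf⟩ := hx f (fun i => ⟨u i, hu0 i⟩) (fun i j h => hu h) hf (fun i j h => by
      have h1 : f j - f i = (X ^ n + f j) - (X ^ n + f i) := by ring
      rw [h1]
      refine (x.sub_le_max _ _).trans (max_le ?_ ?_)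
      · rw [hfu]
        exact hu.antitone h
      · rw [hfu]
        exact le_rfl)
    apply hS
    refine ⟨g, hg, le_antisymm (ge_of_tendsto' htend fun i => ?_) (hglb.1 ⟨g, hg, rfl⟩)⟩
    have h1 : X ^ n + g = (g - f i) + (X ^ n + f i) := by ring
    rw [h1]
    exact (x.add_le_max _ _).trans (max_le (hgf i) (hfu i).le)
  obtain ⟨f, hf, hfS⟩ := hmem
  refine ⟨X ^ n + f, monic_X_pow_add hf, ?_, fun g hg => ?_⟩
  · rw [natDegree_add_eq_left_of_degree_lt (by rwa [degree_X_pow]), natDegree_X_pow]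
  rw [hfS, add_assoc]
  exact hglb.1 ⟨f + g, (degree_add_le _ _).trans_lt (max_lt hf hg), rfl⟩

/-- A minimal monic `P` of degree `n` splits the next space into the orthogonal sum of `k P` and the
polynomials of lower degree, and a centre can be found in each summand separately. -/
theorem sphericallyCompleteBelow (hk : MaximallyComplete k) (x : BerkovichLine k) (n : ℕ) :
    x.SphericallyCompleteBelow n := by
  induction n with
  | zero =>
    intro f r _ hf _
    have h : ∀ i, f i = 0 := fun i => by simpa using hf i
    exact ⟨0, by simp, fun i => by simp [h]⟩
  | succ n ih =>
    intro f r hr hf hfr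
    obtain ⟨P, hP, hPn, hmin⟩ := ih.exists_minimal
    set h : ℕ → k[X] := fun i => f i - C ((f i).coeff n) * P with hh
    have hdeg : ∀ i, degree (h i) < n := fun i => degree_sub_C_coeff_mul_lt (hf i) hP hPn
    have hsplit : ∀ i j, f j - f i = C ((f j).coeff n - (f i).coeff n) * P + (h j - h i) := by
      intro i j
      simp only [hh, map_sub]
      ring
    have hcoeff : ∀ i j, i ≤ j → ‖(f j).coeff n - (f i).coeff n‖ * x P ≤ r i := fun i j hij =>
      (norm_mul_le_of_forall_le hmin _
        ((degree_sub_le _ _).trans_lt (max_lt (hdeg j) (hdeg i)))).trans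
        ((congrArg x (hsplit i j)).symm.trans_le (hfr i j hij))
    obtain ⟨c, hc⟩ : ∃ c : k, ∀ i, ‖c - (f i).coeff n‖ * x P ≤ r i := by
      -- If `x P = 0`, the coefficient of `P` is invisible to `x` and any `c` does.
      rcases (x.nonneg P).eq_or_lt with h0 | h0
      · exact ⟨0, fun i => by rw [← h0, mul_zero]; exact (r i).2⟩
      · obtain ⟨δ, hδ⟩ : ∃ δ : ℝ≥0, (δ : ℝ) = x P := ⟨⟨x P, h0.le⟩, rfl⟩
        rw [← hδ] at h0 hcoeff ⊢
        obtain ⟨c, hc⟩ := hk.exists_forall_norm_sub_le (a := fun i => (f i).coeff n)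
          (r := fun i => r i / δ)
          (fun i j hij => div_lt_div_of_pos_right (hr hij) (by exact_mod_cast h0))
          (fun i j hij => (le_div_iff₀ h0).2 (hcoeff i j hij))
        exact ⟨c, fun i => (le_div_iff₀ h0).1 (hc i)⟩
    obtain ⟨g, hg, hgh⟩ := ih h r hr hdeg fun i j hij => by
      have h1 : h j - h i = (f j - f i) - C ((f j).coeff n - (f i).coeff n) * P := by
        rw [hsplit]; ring
      rw [h1]
      refine (x.sub_le_max _ _).trans (max_le (hfr i j hij) ?_)
      rw [apply_C_mul]
      exact hcoeff i j hij
    refine ⟨C c * P + g, ?_, fun i => ?_⟩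
    · refine (degree_add_le _ _).trans_lt (max_lt ?_ (hg.trans (by norm_cast; omega)))
      rw [← smul_eq_C_mul]
      refine (degree_smul_le c P).trans_lt ?_
      rw [degree_eq_natDegree hP.ne_zero, hPn]
      exact_mod_cast n.lt_succ_self
    · have h1 : C c * P + g - f i = C (c - (f i).coeff n) * P + (g - h i) := by
        simp only [hh, map_sub]
        ring
      rw [h1]
      refine (x.add_le_max _ _).trans (max_le ?_ (hgh i))
      rw [apply_C_mul]
      exact hc i

/-- Over a maximally complete field, the minimal absolute value at `x` of a monic polynomial of
given degree is attained. -/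
theorem exists_minimal (hk : MaximallyComplete k) (x : BerkovichLine k) (n : ℕ) :
    ∃ P : k[X], P.Monic ∧ P.natDegree = n ∧ ∀ f, degree f < n → x P ≤ x (P + f) :=
  (sphericallyCompleteBelow hk x n).exists_minimal

end

/-! ### Uniqueness of the point where an irreducible polynomial vanishes -/

theorem apply_mod {x : BerkovichLine k} {P : k[X]} (hP : x P = 0) (f : k[X]) : x (f % P) = x f := by
  have h : f - f % P = P * (f / P) := by
    rw [sub_eq_iff_eq_add]
    exact (EuclideanDomain.div_add_mod _ _).symm
  have h1 := abs_sub_map_le_sub x f (f % P)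
  rw [h, map_mul, hP, zero_mul] at h1
  exact (sub_eq_zero.mp (abs_nonpos_iff.mp h1)).symm

theorem apply_ne_zero_of_degree_lt {x : BerkovichLine k} {P : k[X]} (hP : Irreducible P)
    (hxP : x P = 0) {f : k[X]} (hf : f ≠ 0) (hfP : degree f < degree P) : x f ≠ 0 := by
  intro hxf
  have hcop : IsCoprime P f :=
    (hP.coprime_iff_not_dvd).2 fun h => (degree_le_of_dvd h hf).not_gt hfP
  obtain ⟨a, b, hab⟩ := hcop
  have h1 : x (a * P + b * f) ≤ 0 := by
    refine (map_add_le_add x _ _).trans_eq ?_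
    rw [map_mul, map_mul, hxP, hxf, mul_zero, mul_zero, add_zero]
  rw [hab, map_one] at h1
  exact h1.not_gt one_pos

variable [IsUltrametricDist k]

/-- Minimal monic polynomials for `z` form an orthogonal basis of non-vanishing vectors, so any
other seminorm is bounded by its values on this basis. -/
theorem exists_forall_apply_le_mul (hk : MaximallyComplete k) {P : k[X]} (hP : Irreducible P)
    (y : BerkovichLine k) {z : BerkovichLine k} (hz : z P = 0) (n : ℕ) (hn : n ≤ P.natDegree) :
    ∃ B, 0 ≤ B ∧ ∀ f, degree f < n → y f ≤ B * z f := by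
  induction n with
  | zero =>
    refine ⟨0, le_rfl, fun f hf => ?_⟩
    have h : f = 0 := by simpa using hf
    simp [h]
  | succ n ih =>
    obtain ⟨B, hB0, hB⟩ := ih (by omega)
    obtain ⟨Q, hQ, hQn, hmin⟩ := exists_minimal hk z n
    have hzQ : 0 < z Q := by
      refine lt_of_le_of_ne (z.nonneg _) (apply_ne_zero_of_degree_lt hP hz hQ.ne_zero ?_).symm
      rw [degree_eq_natDegree hQ.ne_zero, degree_eq_natDegree hP.ne_zero]
      norm_cast
      omega
    refine ⟨max (y Q / z Q) B, le_max_of_le_right hB0, fun f hf => ?_⟩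
    set c := f.coeff n
    set h := f - C c * Q with hh
    have hdeg : degree h < n := degree_sub_C_coeff_mul_lt hf hQ hQn
    have hfh : f = C c * Q + h := by rw [hh]; ring
    have h1 : ‖c‖ * z Q ≤ z f := by
      rw [hfh]
      exact norm_mul_le_of_forall_le hmin c hdeg
    have h2 : z h ≤ z f := by
      refine (z.sub_le_max _ _).trans (max_le le_rfl ?_)
      rwa [apply_C_mul]
    calc y f ≤ max (y (C c * Q)) (y h) := by
          conv_lhs => rw [hfh]
          exact y.add_le_max _ _
      _ ≤ max (y Q / z Q * z f) (B * z f) := by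
        apply max_le_max
        · rw [apply_C_mul]
          calc ‖c‖ * y Q = y Q / z Q * (‖c‖ * z Q) := by field_simp
            _ ≤ _ := by
              gcongr
        · exact (hB h hdeg).trans (by gcongr)
      _ = _ := (max_mul_of_nonneg _ _ (z.nonneg _)).symm

/-- There is at most one point at which an irreducible polynomial vanishes. -/
theorem le_of_apply_eq_zero (hk : MaximallyComplete k) {P : k[X]} (hP : Irreducible P)
    {y z : BerkovichLine k} (hy : y P = 0) (hz : z P = 0) : y ≤ z := by
  obtain ⟨B, hB0, hB⟩ := exists_forall_apply_le_mul hk hP y hz _ le_rfl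
  have key : ∀ f, y f ≤ B * z f := fun f => by
    rw [← apply_mod hy, ← apply_mod hz f]
    refine hB _ ?_
    rw [← degree_eq_natDegree hP.ne_zero]
    exact EuclideanDomain.mod_lt f hP.ne_zero
  intro f
  by_contra! hlt
  rcases (z.nonneg f).eq_or_lt with h0 | h0
  · have := key f
    rw [← h0, mul_zero] at this
    exact this.not_gt (h0 ▸ hlt)
  -- Applying the bound to powers of `f` removes the constant `B`.
  · obtain ⟨m, hm⟩ := pow_unbounded_of_one_lt B ((one_lt_div h0).2 hlt)
    rw [div_pow, lt_div_iff₀ (pow_pos h0 m), ← map_pow, ← map_pow] at hm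
    exact (key (f ^ m)).not_gt hm

theorem eq_of_apply_eq_zero (hk : MaximallyComplete k) {P : k[X]} (hP : Irreducible P)
    {y z : BerkovichLine k} (hy : y P = 0) (hz : z P = 0) : y = z :=
  le_antisymm (le_of_apply_eq_zero hk hP hy hz) (le_of_apply_eq_zero hk hP hz hy)

end BerkovichLine

/-! ### Discs over an algebraically closed extension -/

/-- Every ultrametric field embeds isometrically in an algebraically closed one. -/
theorem IsUltrametricDist.exists_isAlgClosed (K : Type u) [NormedField K] [IsUltrametricDist K] :
    ∃ (Ω : Type u) (_ : NormedField Ω) (_ : IsUltrametricDist Ω) (_ : IsAlgClosed Ω)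
      (ι : K →+* Ω), ∀ a, ‖ι a‖ = ‖a‖ := by
  -- The radius `2` gives `X` absolute value greater than `1`. The completion is then non-trivially
  -- valued even if `K` is not, as the spectral norm requires.
  obtain ⟨L, hL, hLu, φ, hφ, -⟩ := (BerkovichLine.gauss (0 : K) 2).exists_residueField
  let M := UniformSpace.Completion L
  have hMu : IsUltrametricDist M := by
    refine IsUltrametricDist.isUltrametricDist_of_forall_norm_natCast_le_one fun n => ?_
    have h : ((n : L) : M) = (n : M) :=
      map_natCast (UniformSpace.Completion.coeRingHom (α := L)) n
    rw [← h, UniformSpace.Completion.norm_coe]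
    exact IsUltrametricDist.norm_natCast_le_one L n
  have hX : 1 < ‖((φ X : L) : M)‖ := by
    have h := BerkovichLine.gauss_X_sub_C_self (0 : K) 2
    rw [C_0, sub_zero] at h
    rw [UniformSpace.Completion.norm_coe, hφ, h]
    norm_num
  let _ : NontriviallyNormedField M :=
    { (inferInstance : NormedField M) with non_trivial := ⟨_, hX⟩ }
  let Ω := AlgebraicClosure M
  let hΩ : NormedField Ω := spectralNorm.normedField M Ω
  refine ⟨Ω, hΩ, ⟨fun a b c => ?_⟩, AlgebraicClosure.isAlgClosed M,
    (algebraMap M Ω).comp (UniformSpace.Completion.coeRingHom.comp (φ.comp C)), fun a => ?_⟩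
  · rw [dist_eq_norm, dist_eq_norm, dist_eq_norm, ← sub_add_sub_cancel a b c]
    exact isNonarchimedean_spectralNorm (a - b) (b - c)
  · refine (spectralNorm_extends (K := M) (L := Ω) ((φ (C a) : L) : M)).trans ?_
    change ‖((φ (C a) : L) : M)‖ = _
    rw [UniformSpace.Completion.norm_coe, hφ, BerkovichLine.apply_C]

theorem IsUltrametricDist.norm_sub_le_max {K : Type*} [NormedField K] [IsUltrametricDist K]
    (a b : K) : ‖a - b‖ ≤ max ‖a‖ ‖b‖ := by
  rw [sub_eq_add_neg, ← norm_neg b]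
  exact norm_add_le_max _ _

theorem Polynomial.hasseDeriv_map {R S : Type*} [Semiring R] [Semiring S] (ι : R →+* S) (i : ℕ)
    (f : R[X]) : hasseDeriv i (f.map ι) = (hasseDeriv i f).map ι := by
  ext n
  simp [hasseDeriv_coeff]

namespace BerkovichLine

/-- Every point is the evaluation at an element of an algebraically closed ultrametric field. -/
theorem exists_eq_norm_eval {k : Type u} [NormedField k] [IsUltrametricDist k]
    (x : BerkovichLine k) :
    ∃ (Ω : Type u) (_ : NormedField Ω) (_ : IsUltrametricDist Ω) (_ : IsAlgClosed Ω)
      (ι : k →+* Ω) (hι : ∀ a, ‖ι a‖ = ‖a‖) (t : Ω), x = comap ι hι (gauss t 0) := by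
  obtain ⟨K, hK, hKu, φ, hφ, -⟩ := x.exists_residueField
  obtain ⟨Ω, hΩ, hΩu, hΩc, j, hj⟩ := IsUltrametricDist.exists_isAlgClosed K
  refine ⟨Ω, hΩ, hΩu, hΩc, j.comp (φ.comp C), fun a => ?_, j (φ X), DFunLike.ext _ _ fun f => ?_⟩
  · rw [RingHom.comp_apply, RingHom.comp_apply, hj, hφ, apply_C]
  · rw [comap_apply, gauss_zero, eval_map, ← hφ, ← hj]
    congr 1
    have h : (eval₂RingHom (j.comp (φ.comp C)) (j (φ X))) = j.comp φ := by
      ext <;> simp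
    exact (RingHom.congr_fun h f).symm

section

variable {Ω : Type u} [NormedField Ω] [IsUltrametricDist Ω]

omit [IsUltrametricDist Ω] in
theorem exists_nearest_root (t : Ω) {p : Polynomial Ω} (hp : p ≠ 0) (hroot : ∃ α, p.eval α = 0) :
    ∃ α, p.eval α = 0 ∧ ∀ β, p.eval β = 0 → ‖t - α‖ ≤ ‖t - β‖ := by
  obtain ⟨α₀, h₀⟩ := hroot
  have hmem : ∀ β, β ∈ p.roots ↔ p.eval β = 0 := fun β => by rw [mem_roots hp, IsRoot.def]
  obtain ⟨α, hα, hmin⟩ := Multiset.exists_min_image (fun β => ‖t - β‖) (s := p.roots)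
    fun h => by simpa [h] using (hmem α₀).2 h₀
  exact ⟨α, (hmem α).1 hα, fun β hβ => hmin β ((hmem β).2 hβ)⟩

/-- A split polynomial has the same absolute value at `t` and at the maximal point of the disc
centred at its root nearest to `t` whose boundary contains `t`. -/
theorem gauss_nearest_root {t α : Ω} {p : Polynomial Ω} (hs : p.Splits)
    (hmin : ∀ β, p.eval β = 0 → ‖t - α‖ ≤ ‖t - β‖) : gauss α ‖t - α‖₊ p = gauss t 0 p := by
  by_cases hp : p = 0
  · rw [hp, map_zero, map_zero]
  rw [hs.eq_prod_roots, map_mul, map_mul, apply_C, apply_C, map_multiset_prod,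
    map_multiset_prod, Multiset.map_map, Multiset.map_map]
  congr 2
  refine Multiset.map_congr rfl fun β hβ => ?_
  have hβ' : ‖t - α‖ ≤ ‖t - β‖ := hmin β (isRoot_of_mem_roots hβ)
  rw [Function.comp_apply, Function.comp_apply, gauss_X_sub_C, gauss_X_sub_C, NNReal.coe_zero,
    max_eq_right (norm_nonneg _), coe_nnnorm]
  apply le_antisymm
  · refine max_le hβ' ?_
    have h : α - β = (t - β) - (t - α) := by ring
    rw [h]
    exact (IsUltrametricDist.norm_sub_le_max _ _).trans (max_le le_rfl hβ')
  · have h : t - β = (t - α) + (α - β) := by ring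
    rw [h]
    exact IsUltrametricDist.norm_add_le_max _ _

end

section

variable {k : Type u} [NormedField k] [IsUltrametricDist k]

/-- The Taylor coefficients of `f` at a root of `P` are values of Hasse derivatives of `f`. Their
absolute values are read at the only point where `P` vanishes, so they depend neither on the root
nor on the extension. -/
theorem comap_gauss_le (hk : MaximallyComplete k) {P : k[X]} (hP : Irreducible P)
    {Ω Ω' : Type u} [NormedField Ω] [IsUltrametricDist Ω] [NormedField Ω'] [IsUltrametricDist Ω']
    {ι : k →+* Ω} (hι : ∀ a, ‖ι a‖ = ‖a‖) {ι' : k →+* Ω'} (hι' : ∀ a, ‖ι' a‖ = ‖a‖)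
    {α : Ω} (hα : (P.map ι).eval α = 0) {α' : Ω'} (hα' : (P.map ι').eval α' = 0) (ρ : ℝ≥0) :
    comap ι hι (gauss α ρ) ≤ comap ι' hι' (gauss α' ρ) := by
  have h0 : comap ι hι (gauss α 0) = comap ι' hι' (gauss α' 0) := by
    apply eq_of_apply_eq_zero hk hP
    · rw [comap_apply, gauss_zero, hα, norm_zero]
    · rw [comap_apply, gauss_zero, hα', norm_zero]
  intro f
  rw [comap_apply, comap_apply]
  obtain ⟨i, hi⟩ := exists_gauss_eq α ρ (f.map ι)
  have h1 : ‖(taylor α (f.map ι)).coeff i‖ = comap ι hι (gauss α 0) (hasseDeriv i f) := by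
    rw [comap_apply, gauss_zero, taylor_coeff, hasseDeriv_map]
  have h2 : ‖(taylor α' (f.map ι')).coeff i‖ = comap ι' hι' (gauss α' 0) (hasseDeriv i f) := by
    rw [comap_apply, gauss_zero, taylor_coeff, hasseDeriv_map]
  rw [hi, h1, h0, ← h2]
  exact le_gauss _ _ _ _

omit [IsUltrametricDist k] in
theorem exists_map_eval_eq_zero {P : k[X]} (hP : Irreducible P) {Ω : Type u} [NormedField Ω]
    [IsAlgClosed Ω] (ι : k →+* Ω) : ∃ α, (P.map ι).eval α = 0 :=
  IsAlgClosed.exists_root (P.map ι) (by rw [degree_map]; exact hP.degree_pos.ne')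

omit [IsUltrametricDist k] in
theorem map_ne_zero_of_irreducible {P : k[X]} (hP : Irreducible P) {Ω : Type u} [NormedField Ω]
    (ι : k →+* Ω) : P.map ι ≠ 0 := (Polynomial.map_ne_zero_iff ι.injective).2 hP.ne_zero

/-- If `x` is the evaluation at `t`, then the greatest point of the disc `{|P| ≤ |P(x)|}` is
induced by a disc containing `t` on its boundary. -/
theorem exists_isGreatest_comap_gauss (hk : MaximallyComplete k) {P : k[X]} (hP : Irreducible P)
    {Ω : Type u} [NormedField Ω] [IsUltrametricDist Ω] [IsAlgClosed Ω]
    {ι : k →+* Ω} (hι : ∀ a, ‖ι a‖ = ‖a‖) (t : Ω) :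
    ∃ α, IsGreatest (disc P (comap ι hι (gauss t 0) P)) (comap ι hι (gauss α ‖t - α‖₊)) := by
  obtain ⟨α, hα, hmin⟩ := exists_nearest_root t (map_ne_zero_of_irreducible hP ι)
    (exists_map_eval_eq_zero hP ι)
  have hval : comap ι hι (gauss α ‖t - α‖₊) P = comap ι hι (gauss t 0) P :=
    gauss_nearest_root (IsAlgClosed.splits _) hmin
  refine ⟨α, hval.le, fun z hz => ?_⟩
  obtain ⟨Ω', _, _, _, ι', hι', t', rfl⟩ := z.exists_eq_norm_eval
  obtain ⟨α', hα', hmin'⟩ := exists_nearest_root t' (map_ne_zero_of_irreducible hP ι')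
    (exists_map_eval_eq_zero hP ι')
  have hval' : comap ι' hι' (gauss α' ‖t' - α'‖₊) P = comap ι' hι' (gauss t' 0) P :=
    gauss_nearest_root (IsAlgClosed.splits _) hmin'
  have heq : comap ι' hι' (gauss α' ‖t' - α'‖₊) = comap ι hι (gauss α ‖t' - α'‖₊) :=
    le_antisymm (comap_gauss_le hk hP hι' hι hα' hα _) (comap_gauss_le hk hP hι hι' hα hα' _)
  refine (comap_mono ι' hι' (gauss_le_gauss (β := α') (σ := ‖t' - α'‖₊) zero_le (le_refl ‖t' - α'‖))).trans ?_
  rw [heq]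
  -- The polynomial `P` vanishes at `α`, so its Gauss norm grows strictly with the radius; a larger
  -- radius for `z` would contradict `z P ≤ x P`.
  refine comap_mono ι hι (gauss_mono α (not_lt.1 fun hlt => ?_))
  have h1 : gauss α ‖t' - α'‖₊ (P.map ι) ≤ gauss α ‖t - α‖₊ (P.map ι) := by
    have h : comap ι' hι' (gauss t' 0) P ≤ comap ι hι (gauss t 0) P := hz
    rwa [← hval, ← hval', heq] at h
  have h2 := gauss_sub_eval_mul_le α hlt.le (P.map ι)
  rw [hα, C_0, sub_zero] at h2
  have h3 : 0 < gauss α ‖t' - α'‖₊ (P.map ι) :=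
    gauss_pos α (pos_of_gt hlt) (map_ne_zero_of_irreducible hP ι)
  have hlt' : (‖t - α‖₊ : ℝ) < ‖t' - α'‖₊ := hlt
  nlinarith [NNReal.coe_nonneg ‖t' - α'‖₊, mul_pos (sub_pos.2 hlt') h3]

theorem exists_isGreatest_disc (hk : MaximallyComplete k) (x : BerkovichLine k) {P : k[X]}
    (hP : Irreducible P) : ∃ y, IsGreatest (disc P (x P)) y := by
  obtain ⟨Ω, _, _, _, ι, hι, t, rfl⟩ := x.exists_eq_norm_eval
  obtain ⟨α, hα⟩ := exists_isGreatest_comap_gauss hk hP hι t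
  exact ⟨_, hα⟩

/-- The maximal points of the discs with `x` on their boundary are comparable. -/
theorem le_or_le_of_isGreatest_disc (hk : MaximallyComplete k) {x y z : BerkovichLine k}
    {P Q : k[X]} (hP : Irreducible P) (hQ : Irreducible Q) (hy : IsGreatest (disc P (x P)) y)
    (hz : IsGreatest (disc Q (x Q)) z) : y ≤ z ∨ z ≤ y := by
  obtain ⟨Ω, _, _, _, ι, hι, t, rfl⟩ := x.exists_eq_norm_eval
  obtain ⟨α, hα⟩ := exists_isGreatest_comap_gauss hk hP hι t
  obtain ⟨β, hβ⟩ := exists_isGreatest_comap_gauss hk hQ hι t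
  rw [hy.unique hα, hz.unique hβ]
  have h : ‖α - β‖ ≤ max ‖t - α‖ ‖t - β‖ := by
    have h1 : α - β = (t - β) - (t - α) := by ring
    rw [h1, max_comm]
    exact IsUltrametricDist.norm_sub_le_max _ _
  rcases le_total ‖t - α‖ ‖t - β‖ with h' | h'
  · exact Or.inl (comap_mono ι hι (gauss_le_gauss h' (h.trans (max_le h' le_rfl))))
  · refine Or.inr (comap_mono ι hι (gauss_le_gauss h' ?_))
    rw [norm_sub_rev]
    exact h.trans (max_le le_rfl h')

end

end BerkovichLine

/-! ### Shilov boundaries and greatest points -/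

namespace BerkovichLine

section

variable {k : Type u} [NormedField k]

instance instT2Space : T2Space (BerkovichLine k) :=
  T2Space.of_injective_continuous (f := fun (x : BerkovichLine k) (P : k[X]) => x P)
    (fun _ _ h => DFunLike.coe_injective h) continuous_induced_dom

/-- A closed boundary of a set contains its greatest element. -/
theorem IsBoundary.mem_of_isGreatest {V Γ : Set (BerkovichLine k)} {y : BerkovichLine k}
    (hΓ : IsBoundary V Γ) (hy : IsGreatest V y) : y ∈ Γ := by
  classical
  obtain ⟨hΓV, hcl, hmax⟩ := hΓ
  rw [← hcl.closure_eq, closure_induced, mem_closure_iff]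
  intro o ho hyo
  obtain ⟨I, U, hU, hIU⟩ := isOpen_pi_iff.1 ho _ hyo
  let J := I.filter fun f => y f ≠ 0
  -- One test function handles a whole basic neighbourhood: since `z ≤ y`, the maximality of the
  -- product of the non-vanishing `f` forces equality at each factor.
  obtain ⟨z, hzΓ, hz⟩ := hmax (∏ f ∈ J, f)
  have hzy : z ≤ y := hy.2 (hΓV hzΓ)
  have hprod : ∏ f ∈ J, y f ≤ ∏ f ∈ J, z f := by
    rw [← map_prod, ← map_prod]
    exact hz y hy.1
  have hJ : ∀ f ∈ J, y f ≠ 0 := fun f hf => (Finset.mem_filter.1 hf).2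
  have hypos : 0 < ∏ f ∈ J, y f :=
    Finset.prod_pos fun f hf => lt_of_le_of_ne (nonneg y f) (hJ f hf).symm
  have hzpos : ∀ f ∈ J, 0 < z f := fun f hf =>
    lt_of_le_of_ne (nonneg z f)
      (Finset.prod_ne_zero_iff.1 (hypos.trans_le hprod).ne' f hf).symm
  have heq : ∀ f ∈ I, z f = y f := fun f hf => by
    by_cases h0 : y f = 0
    · rw [h0]
      exact le_antisymm (h0 ▸ hzy f) (nonneg z f)
    · refine (hzy f).eq_of_not_lt fun hlt => hprod.not_gt ?_
      exact Finset.prod_lt_prod hzpos (fun g _ => hzy g)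
        ⟨f, Finset.mem_filter.2 ⟨hf, h0⟩, hlt⟩
  refine ⟨_, hIU fun f hf => ?_, z, hzΓ, rfl⟩
  change z f ∈ U f
  rw [heq f hf]
  exact (hU f hf).2

theorem isShilovBoundary_singleton_iff {V : Set (BerkovichLine k)} {y : BerkovichLine k} :
    IsShilovBoundary V {y} ↔ IsGreatest V y := by
  constructor
  · rintro ⟨⟨hV, -, hmax⟩, -⟩
    refine ⟨hV rfl, fun z hz f => ?_⟩
    obtain ⟨w, rfl, hw⟩ := hmax f
    exact hw z hz
  · intro hy
    refine ⟨⟨Set.singleton_subset_iff.2 hy.1, isClosed_singleton, fun f =>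
      ⟨y, rfl, fun z hz => hy.2 hz f⟩⟩, fun Δ hΔ => ?_⟩
    exact Set.singleton_subset_iff.2 (IsBoundary.mem_of_isGreatest hΔ hy)

variable [IsUltrametricDist k]

theorem isEta_iff (hk : MaximallyComplete k) {P : k[X]} (hP : Irreducible P) {r : ℝ} (hr : 0 ≤ r)
    {y : BerkovichLine k} : IsEta P r y ↔ IsGreatest (disc P r) y := by
  unfold IsEta
  rw [isShilovBoundary_singleton_iff]
  constructor
  · rintro (⟨rfl, hy⟩ | ⟨-, hy⟩)
    · exact ⟨hy.le, fun z hz => le_of_apply_eq_zero hk hP (le_antisymm hz (z.nonneg P)) hy⟩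
    · exact hy
  · intro hy
    rcases hr.eq_or_lt with rfl | h
    · exact Or.inl ⟨rfl, le_antisymm hy.1 (y.nonneg P)⟩
    · exact Or.inr ⟨h, hy⟩

/-! ### Agreement with `x`, degree by degree -/

omit [IsUltrametricDist k] in
theorem agreeUpTo_zero (y x : BerkovichLine k) : AgreeUpTo 0 y x := fun P hP => by
  rw [eq_C_of_natDegree_le_zero hP, apply_C, apply_C]

theorem AgreeUpTo.succ {d : ℕ} {x y : BerkovichLine k} (h : AgreeUpTo d y x) (hxy : x ≤ y)
    {P : k[X]} (hP : P.Monic) (hPd : P.natDegree = d + 1)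
    (hmin : ∀ f, degree f < (d + 1 : ℕ) → x P ≤ x (P + f)) (hPy : y P ≤ x P) :
    AgreeUpTo (d + 1) y x := by
  intro f hf
  refine le_antisymm ?_ (hxy f)
  set c := f.coeff (d + 1)
  set g := f - C c * P with hg
  have hdeg : degree g < (d + 1 : ℕ) := degree_sub_C_coeff_mul_lt
    ((degree_le_of_natDegree_le hf).trans_lt (by norm_cast; omega)) hP hPd
  have hgd : g.natDegree ≤ d :=
    natDegree_le_iff_degree_le.2 (Order.lt_succ_iff.1 (by exact_mod_cast hdeg))
  have hfg : f = C c * P + g := by rw [hg]; ring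
  have h1 : ‖c‖ * x P ≤ x f := by
    rw [hfg]
    exact norm_mul_le_of_forall_le hmin c hdeg
  have h2 : x g ≤ x f := by
    refine (x.sub_le_max _ _).trans (max_le le_rfl ?_)
    rwa [apply_C_mul]
  calc y f ≤ max (y (C c * P)) (y g) := by
        conv_lhs => rw [hfg]
        exact y.add_le_max _ _
    _ ≤ x f := by
      refine max_le ?_ ((h g hgd).trans_le h2)
      rw [apply_C_mul]
      exact (mul_le_mul_of_nonneg_left hPy (norm_nonneg c)).trans h1

omit [IsUltrametricDist k] in
/-- A monic polynomial whose value changes between two points that agree in lower degree is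
irreducible. -/
theorem AgreeUpTo.irreducible {d : ℕ} {x y : BerkovichLine k} (h : AgreeUpTo d y x)
    {P : k[X]} (hP : P.Monic) (hPd : P.natDegree = d + 1) (hPy : x P ≠ y P) :
    Irreducible P := by
  refine hP.irreducible_iff_natDegree.2 ⟨?_, fun f g hf hg hfg => ?_⟩
  · rintro rfl
    simp at hPd
  · by_contra! hcon
    have hdeg : f.natDegree + g.natDegree = d + 1 := by
      rw [← hf.natDegree_mul hg, hfg, hPd]
    apply hPy
    rw [← hfg, map_mul, map_mul, h f (by omega), h g (by omega)]

theorem exists_isGreatest_disc_agreeUpTo (hk : MaximallyComplete k) (x : BerkovichLine k) (d : ℕ) :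
    ∃ P : k[X], Irreducible P ∧ P.natDegree ≤ d + 1 ∧
      ∃ y, IsGreatest (disc P (x P)) y ∧ AgreeUpTo (d + 1) y x := by
  have step : ∀ d (P : k[X]), P.Monic → P.natDegree = d + 1 →
      (∀ f, degree f < (d + 1 : ℕ) → x P ≤ x (P + f)) → Irreducible P →
      (∀ y, IsGreatest (disc P (x P)) y → AgreeUpTo d y x) →
      ∃ P : k[X], Irreducible P ∧ P.natDegree ≤ d + 1 ∧
        ∃ y, IsGreatest (disc P (x P)) y ∧ AgreeUpTo (d + 1) y x := by
    intro d P hP hPd hmin hirr hag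
    obtain ⟨y, hy⟩ := exists_isGreatest_disc hk x hirr
    exact ⟨P, hirr, hPd.le, y, hy, (hag y hy).succ (hy.2 (le_refl (x P))) hP hPd hmin hy.1⟩
  induction d with
  | zero =>
    obtain ⟨P, hP, hPd, hmin⟩ := exists_minimal hk x 1
    exact step 0 P hP hPd hmin (irreducible_of_degree_eq_one (by
      rw [degree_eq_natDegree hP.ne_zero, hPd]; rfl)) fun y _ => agreeUpTo_zero y x
  | succ d ih =>
    obtain ⟨Q, hQ, hQd, z, hz, hzx⟩ := ih
    obtain ⟨P, hP, hPd, hmin⟩ := exists_minimal hk x (d + 2)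
    have hxz : x ≤ z := hz.2 (le_refl (x Q))
    -- If `x P < z P`, a factor of `P` would have a degree in which `z` and `x` agree, so `P` is
    -- irreducible. Comparability then puts the new point `y` below `z`, since `z ≤ y` would give `z
    -- P ≤ x P`.
    by_cases hzP : z P ≤ x P
    · exact ⟨Q, hQ, by omega, z, hz, hzx.succ hxz hP hPd hmin hzP⟩
    · rw [not_le] at hzP
      have hirr := hzx.irreducible hP hPd hzP.ne
      refine step (d + 1) P hP hPd hmin hirr fun y hy f hf => ?_
      have hyz : y ≤ z := by
        refine (le_or_le_of_isGreatest_disc hk hirr hQ hy hz).resolve_right fun h => ?_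
        exact hzP.not_ge ((h P).trans hy.1)
      exact le_antisymm ((hyz f).trans_eq (hzx f hf)) (hy.2 (le_refl (x P)) f)

/-! ### Comparison of the points of `D k d` -/

/-- Every point of `D k d` is the greatest point of a disc `{|P| ≤ r}` with `P` of degree at most
`d`, or, when `d = 0`, of the closed unit disc. -/
theorem exists_isGreatest_of_mem_D (hk : MaximallyComplete k) {d : ℕ} {y : BerkovichLine k}
    (hy : y ∈ D k d) :
    ∃ P r, IsGreatest (disc P r) y ∧ (d = 0 ∧ P = X ∧ r = 1 ∨ 1 ≤ d ∧ P.natDegree ≤ d) := by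
  rcases hy with ⟨hd, hy⟩ | ⟨hd, P, hP, hPd, r, hr, hy⟩
  · exact ⟨X, 1, (isEta_iff hk irreducible_X zero_le_one).1 hy, Or.inl ⟨hd, rfl, rfl⟩⟩
  · exact ⟨P, r, (isEta_iff hk hP hr).1 hy, Or.inr ⟨hd, hPd⟩⟩

/-- A point agreeing up to degree `d` with `x` lies below every point of `D k d` above `x`. -/
theorem AgreeUpTo.le_of_mem_D (hk : MaximallyComplete k) {d : ℕ} {x y z : BerkovichLine k}
    (hy : y ∈ D k d) (hz : z ∈ D k d) (hyx : AgreeUpTo d y x) (hzx : d = 0 ∨ x ≤ z) : y ≤ z := by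
  obtain ⟨P, r, hP, ⟨hd, rfl, rfl⟩ | ⟨hd, hPd⟩⟩ := exists_isGreatest_of_mem_D hk hz
  · obtain ⟨Q, s, hQ, ⟨-, rfl, rfl⟩ | ⟨hd', -⟩⟩ := exists_isGreatest_of_mem_D hk hy
    · exact hP.2 hQ.1
    · omega
  · have hxz : x ≤ z := hzx.resolve_left (by omega)
    exact hP.2 ((hyx P hPd).trans_le ((hxz P).trans hP.1))

theorem AgreeUpTo.le (hk : MaximallyComplete k) {d : ℕ} {x y : BerkovichLine k}
    (hy : y ∈ D k d) (hyx : AgreeUpTo d y x) (hd : 1 ≤ d ∨ x X ≤ 1) : x ≤ y := by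
  obtain ⟨P, r, hP, ⟨hd0, rfl, rfl⟩ | ⟨-, hPd⟩⟩ := exists_isGreatest_of_mem_D hk hy
  · exact hP.2 (hd.resolve_left (by omega))
  · exact hP.2 ((hyx P hPd).symm.trans_le hP.1)

theorem exists_mem_D_agreeUpTo (hk : MaximallyComplete k) (x : BerkovichLine k) (d : ℕ) :
    ∃ y ∈ D k d, AgreeUpTo d y x := by
  rcases d with _ | d
  · have h := isGreatest_gauss (0 : k) 1
    rw [C_0, sub_zero, NNReal.coe_one] at h
    exact ⟨_, Or.inl ⟨rfl, (isEta_iff hk irreducible_X zero_le_one).2 h⟩, agreeUpTo_zero _ _⟩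
  · obtain ⟨P, hP, hPd, y, hy, hyx⟩ := exists_isGreatest_disc_agreeUpTo hk x d
    exact ⟨y, Or.inr ⟨by omega, P, hP, hPd, x P, x.nonneg P, (isEta_iff hk hP (x.nonneg P)).2 hy⟩,
      hyx⟩

end

end BerkovichLine

theorem theorem1 {k : Type u} [NormedField k] [IsUltrametricDist k] [CompleteSpace k]
    (hk : MaximallyComplete k) (x : BerkovichLine k) (d : ℕ) :
    (∃! xd : BerkovichLine k,
      xd ∈ BerkovichLine.D k d ∧ BerkovichLine.AgreeUpTo d xd x) ∧
    (∀ xd : BerkovichLine k,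
      xd ∈ BerkovichLine.D k d → BerkovichLine.AgreeUpTo d xd x →
      (1 ≤ d ∨ x X ≤ 1) →
        x ≤ xd ∧ IsGLB {y | y ∈ BerkovichLine.D k d ∧ x ≤ y} xd) := by
  have hle : ∀ y, y ∈ BerkovichLine.D k d → y.AgreeUpTo d x → d = 0 ∨ x ≤ y := fun y hy hyx =>
    d.eq_zero_or_pos.imp_right fun hd => hyx.le hk hy (Or.inl hd)
  constructor
  · obtain ⟨y, hy, hyx⟩ := BerkovichLine.exists_mem_D_agreeUpTo hk x d
    refine ⟨y, ⟨hy, hyx⟩, fun z ⟨hz, hzx⟩ => le_antisymm ?_ ?_⟩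
    · exact hzx.le_of_mem_D hk hz hy (hle y hy hyx)
    · exact hyx.le_of_mem_D hk hy hz (hle z hz hzx)
  · intro y hy hyx hd
    have hxy := hyx.le hk hy hd
    -- The infimum is attained: `y` itself belongs to the set.
    exact ⟨hxy, IsLeast.isGLB ⟨⟨hy, hxy⟩, fun z hz => hyx.le_of_mem_D hk hy hz.1 (Or.inr hz.2)⟩⟩
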